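/- Let $V\in L^1_{loc}(\mathbb R)$ be a complex-valued periodic function with period $\omega>0$ that is $\mathcal{PT}$-symmetric, i.e. $V(x+\omega)=V(x)$ and $\overline{V(-x)}=V(x)$ for almost every $x\in\mathbb R$. Let $H$ be the Hill operator in $L^2(\mathbb R)$ given by $Hf=-f''+Vf$ on the domain $$\mathrm{dom}(H)=\{g\in L^2(\mathbb R) : g,\,g'\in AC_{loc}(\mathbb R),\ -g''+Vg\in L^2(\mathbb R)\},$$ and let $\sigma(H)\subset\mathbb C$ be its spectrum, the complement of the set of $E\in\mathbb C$ for which $H-E:\mathrm{dom}(H)\to L^2(\mathbb R)$ is bijective with bounded inverse. For all $E,a,b\in\mathbb C$ the equation $-\psi''+V\psi=E\psi$ (with $\psi,\psi'\in AC_{loc}(\mathbb R)$, the equation holding almost everywhere) has exactly one solution on $\mathbb R$ with $\psi(0)=a$, $\psi'(0)=b$. Let $\phi_1(E,\cdot)$ and $\phi_2(E,\cdot)$ be the solutions with $\phi_1(E,0)=1$, $\phi_1'(E,0)=0$ and $\phi_2(E,0)=0$, $\phi_2'(E,0)=1$, and let $$\Delta(E)=\tfrac12\left(\phi_1(E,\omega)+\phi_2'(E,\omega)\right),\qquad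 E\in\mathbb C,$$ be the Floquet discriminant. Then: 1. $\Delta(E)$ is real for every $E\in\mathbb R$. 2. $\sigma(H)$ is symmetric about the real axis: $\overline E\in\sigma(H)$ if and only if $E\in\sigma(H)$. 3. If the function $\mathbb R\ni E\mapsto\Delta(E)$ has a local maximum or a local minimum at some $E_0\in\mathbb R$ with $-1<\Delta(E_0)<1$, then $\sigma(H)$ contains a nonreal point. -/

import Mathlib

open MeasureTheory
open scoped ComplexConjugate

noncomputable section

namespace Hill

/-- `g ∈ AC_loc(ℝ)`: `g` is absolutely continuous on every compact interval. -/
def LocallyAC (g : ℝ → ℂ) : Prop :=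
  ∀ a b : ℝ, AbsolutelyContinuousOnInterval g a b

/-- `g, g' ∈ AC_loc(ℝ)`. (Once `g` and `g'` lie in `AC_loc(ℝ)`, the function `g` is
differentiable everywhere; this is recorded so that `deriv g` is the derivative at every point.) -/
structure Regular (g : ℝ → ℂ) : Prop where
  locallyAC : LocallyAC g
  differentiable : Differentiable ℝ g
  locallyAC_deriv : LocallyAC (deriv g)

/-- The differential expression `-g'' + V g` (for `g, g' ∈ AC_loc(ℝ)` the second derivative
exists almost everywhere). -/
def expr (V : ℝ → ℂ) (g : ℝ → ℂ) (x : ℝ) : ℂ :=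
  -deriv (deriv g) x + V x * g x

theorem LocallyAC.add {f g : ℝ → ℂ} (hf : LocallyAC f) (hg : LocallyAC g) :
    LocallyAC (f + g) := fun a b => (hf a b).add (hg a b)

theorem LocallyAC.smul {f : ℝ → ℂ} (c : ℂ) (hf : LocallyAC f) :
    LocallyAC (c • f) := fun a b => (hf a b).const_smul c

theorem LocallyAC.ae_differentiableAt {f : ℝ → ℂ} (hf : LocallyAC f) :
    ∀ᵐ x : ℝ, DifferentiableAt ℝ f x := by
  have h : LocallyBoundedVariationOn f Set.univ := by
    intro a b _ _
    by_cases hab : a ≤ b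
    · have := (hf a b).boundedVariationOn
      rw [Set.uIcc_of_le hab] at this
      simpa using this
    · simp [Set.Icc_eq_empty hab]
  exact h.ae_differentiableAt

theorem Regular.deriv_add {f g : ℝ → ℂ} (hf : Regular f) (hg : Regular g) :
    deriv (f + g) = deriv f + deriv g :=
  funext fun x => _root_.deriv_add (hf.differentiable x) (hg.differentiable x)

theorem Regular.deriv_smul {f : ℝ → ℂ} (c : ℂ) (hf : Regular f) :
    deriv (c • f) = c • deriv f :=
  funext fun x => deriv_const_smul c (hf.differentiable x)

theorem regular_zero : Regular 0 where
  locallyAC := fun a b => by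
    simpa using (LipschitzOnWith.absolutelyContinuousOnInterval (K := 0) (f := (0 : ℝ → ℂ))
      (a := a) (b := b) (by intro x _ y _; simp))
  differentiable := differentiable_const 0
  locallyAC_deriv := fun a b => by
    have h : deriv (0 : ℝ → ℂ) = 0 := by ext x; simp
    rw [h]
    simpa using (LipschitzOnWith.absolutelyContinuousOnInterval (K := 0) (f := (0 : ℝ → ℂ))
      (a := a) (b := b) (by intro x _ y _; simp))

theorem Regular.add {f g : ℝ → ℂ} (hf : Regular f) (hg : Regular g) : Regular (f + g) where
  locallyAC := hf.locallyAC.add hg.locallyAC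
  differentiable := hf.differentiable.add hg.differentiable
  locallyAC_deriv := by
    rw [hf.deriv_add hg]; exact hf.locallyAC_deriv.add hg.locallyAC_deriv

theorem Regular.smul {f : ℝ → ℂ} (c : ℂ) (hf : Regular f) : Regular (c • f) where
  locallyAC := hf.locallyAC.smul c
  differentiable := hf.differentiable.const_smul c
  locallyAC_deriv := by
    rw [hf.deriv_smul c]; exact hf.locallyAC_deriv.smul c

theorem expr_add (V : ℝ → ℂ) {f g : ℝ → ℂ} (hf : Regular f) (hg : Regular g) :
    expr V (f + g) =ᵐ[volume] expr V f + expr V g := by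
  filter_upwards [hf.locallyAC_deriv.ae_differentiableAt,
    hg.locallyAC_deriv.ae_differentiableAt] with x h1 h2
  simp only [expr, Pi.add_apply]
  rw [hf.deriv_add hg, _root_.deriv_add h1 h2]
  ring

theorem expr_smul (V : ℝ → ℂ) {f : ℝ → ℂ} (c : ℂ) (hf : Regular f) :
    expr V (c • f) =ᵐ[volume] c • expr V f := by
  filter_upwards [hf.locallyAC_deriv.ae_differentiableAt] with x h1
  simp only [expr, Pi.smul_apply, smul_eq_mul]
  rw [hf.deriv_smul c, deriv_const_smul c h1, smul_eq_mul]
  ring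

theorem expr_zero (V : ℝ → ℂ) : expr V 0 = 0 := by
  have h : deriv (0 : ℝ → ℂ) = 0 := by ext x; simp
  ext x
  simp [expr, h]

/-- The Hilbert space `L²(ℝ)`. -/
abbrev L2 : Type := Lp ℂ 2 (volume : Measure ℝ)

/-- The domain of the Hill operator: all `f ∈ L²(ℝ)` with `f, f' ∈ AC_loc(ℝ)` and
`-f'' + V f ∈ L²(ℝ)`. An element of `L²(ℝ)` being a class of functions modulo null sets, `f` is
tested through a representative `g`; that representative is unique because it is continuous. -/
def domain (V : ℝ → ℂ) : Submodule ℂ L2 where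
  carrier := {f | ∃ g : ℝ → ℂ, f =ᵐ[volume] g ∧ Regular g ∧ MemLp (expr V g) 2 volume}
  zero_mem' := ⟨0, Lp.coeFn_zero ℂ 2 volume, regular_zero, by rw [expr_zero]; exact MemLp.zero⟩
  add_mem' := by
    rintro f₁ f₂ ⟨g₁, e₁, r₁, m₁⟩ ⟨g₂, e₂, r₂, m₂⟩
    exact ⟨g₁ + g₂, (Lp.coeFn_add f₁ f₂).trans (e₁.add e₂), r₁.add r₂,
      (m₁.add m₂).ae_eq (expr_add V r₁ r₂).symm⟩
  smul_mem' := by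
    rintro c f ⟨g, e, r, m⟩
    exact ⟨c • g, (Lp.coeFn_smul c f).trans (e.const_smul c), r.smul c,
      (m.const_smul c).ae_eq (expr_smul V c r).symm⟩

/-- The representative of `f ∈ domain V` with `f, f' ∈ AC_loc(ℝ)`. -/
def rep {V : ℝ → ℂ} (f : domain V) : ℝ → ℂ := Classical.choose f.2

theorem rep_spec {V : ℝ → ℂ} (f : domain V) :
    (f : L2) =ᵐ[volume] rep f ∧ Regular (rep f) ∧ MemLp (expr V (rep f)) 2 volume :=
  Classical.choose_spec f.2

theorem rep_unique {V : ℝ → ℂ} (f : domain V) {g : ℝ → ℂ} (hg : Regular g)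
    (h : (f : L2) =ᵐ[volume] g) : rep f = g :=
  Continuous.ae_eq_iff_eq volume (rep_spec f).2.1.differentiable.continuous
    hg.differentiable.continuous |>.1 ((rep_spec f).1.symm.trans h)

theorem rep_add {V : ℝ → ℂ} (f₁ f₂ : domain V) : rep (f₁ + f₂) = rep f₁ + rep f₂ :=
  rep_unique _ ((rep_spec f₁).2.1.add (rep_spec f₂).2.1)
    ((Lp.coeFn_add (f₁ : L2) f₂).trans ((rep_spec f₁).1.add (rep_spec f₂).1))

theorem rep_smul {V : ℝ → ℂ} (c : ℂ) (f : domain V) : rep (c • f) = c • rep f :=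
  rep_unique _ ((rep_spec f).2.1.smul c)
    ((Lp.coeFn_smul c (f : L2)).trans ((rep_spec f).1.const_smul c))

/-- The Hill operator `H f = -f'' + V f` in `L²(ℝ)`, with domain `domain V`. -/
def hillOperator (V : ℝ → ℂ) : L2 →ₗ.[ℂ] L2 where
  domain := domain V
  toFun :=
    { toFun := fun f => (rep_spec f).2.2.toLp (expr V (rep f))
      map_add' := by
        intro f₁ f₂
        rw [← MemLp.toLp_add]
        refine MemLp.toLp_congr _ _ ?_
        rw [rep_add]
        exact expr_add V (rep_spec f₁).2.1 (rep_spec f₂).2.1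
      map_smul' := by
        intro c f
        rw [RingHom.id_apply, ← MemLp.toLp_const_smul]
        refine MemLp.toLp_congr _ _ ?_
        rw [rep_smul]
        exact expr_smul V c (rep_spec f).2.1 }

/-- The spectrum of a (not necessarily bounded) operator `T` in `L²(ℝ)`: the complement of the
set of all `E ∈ ℂ` for which `T - E` is a bijection of its domain onto `L²(ℝ)` whose inverse `R`
is a bounded operator on `L²(ℝ)`. -/
def spectrum (T : L2 →ₗ.[ℂ] L2) : Set ℂ :=
  {E | ¬ ∃ R : L2 →L[ℂ] L2,
    (∀ h : L2, ∃ f : T.domain, (f : L2) = R h ∧ T f - E • (f : L2) = h) ∧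
    (∀ f : T.domain, R (T f - E • (f : L2)) = f)}

/-- `ψ` is a solution on `ℝ` of `-ψ'' + V ψ = E ψ`: `ψ, ψ' ∈ AC_loc(ℝ)` and the equation holds
almost everywhere. -/
def IsSolution (V : ℝ → ℂ) (E : ℂ) (ψ : ℝ → ℂ) : Prop :=
  Regular ψ ∧ ∀ᵐ x : ℝ, -deriv (deriv ψ) x + V x * ψ x = E * ψ x

/-- `ψ` is a solution of `-ψ'' + V ψ = E ψ` with `ψ(0) = a` and `ψ'(0) = b`. -/
def IsSolutionWith (V : ℝ → ℂ) (E a b : ℂ) (ψ : ℝ → ℂ) : Prop :=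
  IsSolution V E ψ ∧ ψ 0 = a ∧ deriv ψ 0 = b

/-- The solution of `-ψ'' + V ψ = E ψ` with `ψ(0) = a` and `ψ'(0) = b`. -/
def solution (V : ℝ → ℂ) (E a b : ℂ) : ℝ → ℂ :=
  Classical.epsilon (IsSolutionWith V E a b)

/-- The solution `φ₁(E, ·)` with `φ₁(E, 0) = 1` and `φ₁'(E, 0) = 0`. -/
def phi₁ (V : ℝ → ℂ) (E : ℂ) : ℝ → ℂ := solution V E 1 0

/-- The solution `φ₂(E, ·)` with `φ₂(E, 0) = 0` and `φ₂'(E, 0) = 1`. -/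
def phi₂ (V : ℝ → ℂ) (E : ℂ) : ℝ → ℂ := solution V E 0 1

/-- The monodromy matrix `M(E)` of `-ψ'' + V ψ = E ψ` for the period `ω`. -/
def monodromy (V : ℝ → ℂ) (ω : ℝ) (E : ℂ) : Matrix (Fin 2) (Fin 2) ℂ :=
  !![phi₁ V E ω, phi₂ V E ω; deriv (phi₁ V E) ω, deriv (phi₂ V E) ω]

/-- The Floquet discriminant `Δ(E) = tr M(E) / 2 = (φ₁(E, ω) + φ₂'(E, ω)) / 2`. -/
def discriminant (V : ℝ → ℂ) (ω : ℝ) (E : ℂ) : ℂ :=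
  (monodromy V ω E).trace / 2

end Hill

end

/-!
The proof has three ingredients.

*Initial value problem.* Written as a first-order system, the equation is the Volterra equation
`Y(x) = c + ∫₀ˣ A_E Y` with a locally integrable coefficient matrix. If `a` dominates the
coefficients, the Volterra operator has norm at most `1 / 2` for the supremum norm weighted by
`cosh (2 ∫₀ˣ a)`, on the whole line at once (`norm_volterra_le`). Hence `1 - K_E` is invertible,
and, `K_E` being affine in `E` and the inversion of operators being holomorphic, the solution and its
derivative at a fixed point are entire functions of `E` (`exists_differentiableOn_system`,
`differentiable_solution`). In particular `Δ` is entire. Uniqueness follows from the constancy of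
Wronskians (`IsSolution.wronskian_eq`).

*Symmetry.* For a `𝒫𝒯`-symmetric potential, `f ↦ (x ↦ conj (f (-x)))` is an antiunitary involution
commuting with `H`; conjugating by it turns a resolvent at `E` into a resolvent at `conj E`
(`mem_spectrum_of_conj_mem`). Applied to `φ₁` it gives `φ₁(E, ω) = conj (φ₁(E, -ω))` for real `E`,
while periodicity gives `φ₁(E, -ω) = φ₂'(E, ω)` (`phi₁_neg_period`), so that `2 Δ(E)` is the sum of
a number and its conjugate.

*Nonreal spectrum.* If `Δ(E) ∈ [-1, 1]`, the monodromy matrix has an eigenvalue of modulus one, and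
the corresponding Bloch solution is bounded but not square integrable; cutting it off at larger and
larger scales shows that `H - E` has no bounded inverse (`mem_spectrum_of_discriminant`). Near a
local extremum `E₀` of its restriction to `ℝ`, the entire function `Δ` is either constant or open.
In the second case it attains near `E₀` real values just beyond the extremal one, and it cannot do
so at real points. In both cases there are nonreal `E` with `Δ(E)` real and close to `Δ(E₀)`
(`exists_nonreal_of_isLocalExtr`).
-/

/-! ### Locally absolutely continuous functions -/

namespace Hill

theorem LocallyAC.of_dist_le {f : ℝ → ℂ} {g : ℝ → ℝ}
    (hg : ∀ a b, AbsolutelyContinuousOnInterval g a b)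
    (h : ∀ x y, dist (f x) (f y) ≤ dist (g x) (g y)) : LocallyAC f := fun a b =>
  squeeze_zero (fun _ => Finset.sum_nonneg fun _ _ => dist_nonneg)
    (fun _ => Finset.sum_le_sum fun _ _ => h _ _) (hg a b)

theorem LocallyAC.mul {f g : ℝ → ℂ} (hf : LocallyAC f) (hg : LocallyAC g) :
    LocallyAC (fun x => f x * g x) := fun a b => (hf a b).smul (hg a b)

theorem LocallyAC.neg {f : ℝ → ℂ} (hf : LocallyAC f) : LocallyAC (fun x => -f x) :=
  fun a b => (hf a b).neg

theorem LocallyAC.sub {f g : ℝ → ℂ} (hf : LocallyAC f) (hg : LocallyAC g) :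
    LocallyAC (fun x => f x - g x) := fun a b => (hf a b).sub (hg a b)

theorem LocallyAC.conj {f : ℝ → ℂ} (hf : LocallyAC f) :
    LocallyAC (fun x => conj (f x)) := by
  intro a b
  have h := hf a b
  simpa only [AbsolutelyContinuousOnInterval, Complex.dist_conj_conj] using h

theorem LocallyAC.comp_neg {f : ℝ → ℂ} (hf : LocallyAC f) :
    LocallyAC (fun x => f (-x)) := by
  intro a b
  rw [absolutelyContinuousOnInterval_iff]
  intro ε hε
  obtain ⟨δ, hδ, H⟩ := (absolutelyContinuousOnInterval_iff _ _ _).1 (hf (-a) (-b)) ε hε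
  refine ⟨δ, hδ, fun E hE hlt => H (E.1, fun i => (-(E.2 i).1, -(E.2 i).2)) ⟨?_, ?_⟩ ?_⟩
  · intro i hi
    have := hE.1 i hi
    simp only [Set.mem_uIcc] at this ⊢
    grind
  · intro i hi j hj hij
    have := hE.2 hi hj hij
    simp only [Function.onFun, Set.uIoc, Set.Ioc_disjoint_Ioc] at this ⊢
    simp only [min_neg_neg, max_neg_neg, neg_le_neg_iff]
    exact this
  · simpa [dist_neg_neg] using hlt

theorem LocallyAC.comp_add_const {f : ℝ → ℂ} (hf : LocallyAC f) (c : ℝ) :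
    LocallyAC (fun x => f (x + c)) := by
  intro a b
  rw [absolutelyContinuousOnInterval_iff]
  intro ε hε
  obtain ⟨δ, hδ, H⟩ := (absolutelyContinuousOnInterval_iff _ _ _).1 (hf (a + c) (b + c)) ε hε
  refine ⟨δ, hδ, fun E hE hlt => H (E.1, fun i => ((E.2 i).1 + c, (E.2 i).2 + c)) ⟨?_, ?_⟩ ?_⟩
  · intro i hi
    have := hE.1 i hi
    simp only [Set.mem_uIcc] at this ⊢
    grind
  · intro i hi j hj hij
    have := hE.2 hi hj hij
    simp only [Function.onFun, Set.uIoc, Set.Ioc_disjoint_Ioc] at this ⊢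
    simp only [min_add_add_right, max_add_add_right, add_le_add_iff_right]
    exact this
  · simpa [dist_add_right] using hlt

theorem _root_.ContDiff.locallyAC {f : ℝ → ℂ} (hf : ContDiff ℝ 1 f) : LocallyAC f :=
  fun _ _ => hf.contDiffOn.absolutelyContinuousOnInterval

theorem LocallyAC.continuous {f : ℝ → ℂ} (hf : LocallyAC f) : Continuous f := by
  refine continuous_iff_continuousAt.2 fun x => (hf (x - 1) (x + 1)).continuousOn.continuousAt ?_
  rw [Set.uIcc_of_le (by linarith)]
  exact Icc_mem_nhds (by linarith) (by linarith)

theorem _root_.MeasureTheory.LocallyIntegrable.intervalIntegrable' {E : Type*}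
    [NormedAddCommGroup E] {f : ℝ → E} (hf : LocallyIntegrable f volume) (a b : ℝ) :
    IntervalIntegrable f volume a b :=
  (hf.integrableOn_isCompact isCompact_uIcc).intervalIntegrable

/-- The primitive of a locally integrable function is locally absolutely continuous. -/
theorem locallyAC_const_add_primitive {f : ℝ → ℂ} (hf : LocallyIntegrable f volume) (c : ℂ) :
    LocallyAC (fun x => c + ∫ t in (0 : ℝ)..x, f t) := by
  have hI := hf.intervalIntegrable'
  have hn : ∀ a b, IntervalIntegrable (fun t => ‖f t‖) volume a b := fun a b => (hI a b).norm
  refine LocallyAC.of_dist_le (g := fun x => ∫ t in (0 : ℝ)..x, ‖f t‖) (fun a b => ?_)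
    fun x y => ?_
  · -- the primitive is first taken over an interval containing the base point `0`
    have h0 : (0 : ℝ) ∈ Set.uIcc (min (min a b) 0) (max (max a b) 0) := by
      simp
    refine ((hn _ _).absolutelyContinuousOnInterval_intervalIntegral h0).mono ?_
    rw [Set.uIcc_of_le (a := min (min a b) 0) (by simp)]
    exact Set.Icc_subset_Icc (by simp) (by simp)
  · rw [dist_comm, dist_comm (∫ t in (0 : ℝ)..x, ‖f t‖), dist_eq_norm, dist_eq_norm,
      add_sub_add_left_eq_sub, intervalIntegral.integral_interval_sub_left (hI _ _) (hI _ _),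
      intervalIntegral.integral_interval_sub_left (hn _ _) (hn _ _)]
    exact intervalIntegral.norm_integral_le_abs_integral_norm

theorem LocallyAC.eq_of_ae_hasDerivAt_zero {f : ℝ → ℂ} (hf : LocallyAC f)
    (h : ∀ᵐ x : ℝ, HasDerivAt f 0 x) (x y : ℝ) : f x = f y := by
  obtain ⟨C, hC⟩ := (hf x y).const_of_ae_hasDerivAt_zero (h.mono fun _ h _ => h)
  rw [hC x Set.left_mem_uIcc, hC y Set.right_mem_uIcc]

/-! ### Solutions, the Wronskian and uniqueness -/

theorem Regular.comp_add_const {g : ℝ → ℂ} (hg : Regular g) (c : ℝ) :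
    Regular (fun x => g (x + c)) where
  locallyAC := hg.locallyAC.comp_add_const c
  differentiable := hg.differentiable.comp (differentiable_id.add_const c)
  locallyAC_deriv := by
    have : deriv (fun x => g (x + c)) = fun x => deriv g (x + c) :=
      funext fun x => deriv_comp_add_const ..
    rw [this]
    exact hg.locallyAC_deriv.comp_add_const c

theorem deriv_conj_comp_neg (g : ℝ → ℂ) :
    deriv (fun x => conj (g (-x))) = fun x => -conj (deriv g (-x)) := by
  funext x
  have := deriv.star (𝕜 := ℝ) (f := fun x => g (-x)) (x := x)
  rw [deriv_comp_neg] at this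
  simpa using this

theorem deriv_deriv_conj_comp_neg (g : ℝ → ℂ) :
    deriv (deriv (fun x => conj (g (-x)))) = fun x => conj (deriv (deriv g) (-x)) := by
  rw [deriv_conj_comp_neg]
  funext x
  rw [deriv.fun_neg, deriv_conj_comp_neg, neg_neg]

theorem Regular.conj_comp_neg {g : ℝ → ℂ} (hg : Regular g) :
    Regular (fun x => conj (g (-x))) where
  locallyAC := hg.locallyAC.comp_neg.conj
  differentiable := (hg.differentiable.comp differentiable_neg).star
  locallyAC_deriv := by
    rw [deriv_conj_comp_neg]
    exact hg.locallyAC_deriv.comp_neg.conj.neg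

theorem ae_comp_neg {p : ℝ → Prop} (h : ∀ᵐ x : ℝ, p x) : ∀ᵐ x : ℝ, p (-x) :=
  (Measure.measurePreserving_neg (volume : Measure ℝ)).quasiMeasurePreserving.ae h

theorem ae_comp_add_const {p : ℝ → Prop} (h : ∀ᵐ x : ℝ, p x) (c : ℝ) : ∀ᵐ x : ℝ, p (x + c) :=
  (measurePreserving_add_right (volume : Measure ℝ) c).quasiMeasurePreserving.ae h

variable {V : ℝ → ℂ} {E a b a' b' : ℂ} {f g : ℝ → ℂ}

theorem IsSolution.add (hf : IsSolution V E f) (hg : IsSolution V E g) :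
    IsSolution V E (f + g) := by
  refine ⟨hf.1.add hg.1, ?_⟩
  filter_upwards [expr_add V hf.1 hg.1, hf.2, hg.2] with x h h1 h2
  simp only [expr, Pi.add_apply] at h
  simp only [Pi.add_apply]
  rw [h, h1, h2, mul_add]

theorem IsSolution.smul (c : ℂ) (hf : IsSolution V E f) : IsSolution V E (c • f) := by
  refine ⟨hf.1.smul c, ?_⟩
  filter_upwards [expr_smul V c hf.1, hf.2] with x h h1
  simp only [expr, Pi.smul_apply, smul_eq_mul] at h
  simp only [Pi.smul_apply, smul_eq_mul]
  rw [h, h1]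
  ring

theorem IsSolutionWith.linearCombination (hf : IsSolutionWith V E a b f)
    (hg : IsSolutionWith V E a' b' g) (c d : ℂ) :
    IsSolutionWith V E (c * a + d * a') (c * b + d * b') (c • f + d • g) := by
  refine ⟨(hf.1.smul c).add (hg.1.smul d), ?_, ?_⟩
  · simp [hf.2.1, hg.2.1]
  · rw [(hf.1.1.smul c).deriv_add (hg.1.1.smul d), hf.1.1.deriv_smul, hg.1.1.deriv_smul]
    simp [hf.2.2, hg.2.2]

theorem IsSolution.comp_add_const {c : ℝ} (hper : ∀ᵐ x : ℝ, V (x + c) = V x)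
    (hf : IsSolution V E f) : IsSolution V E (fun x => f (x + c)) := by
  refine ⟨hf.1.comp_add_const c, ?_⟩
  have h1 : deriv (fun x => f (x + c)) = fun x => deriv f (x + c) :=
    funext fun x => deriv_comp_add_const ..
  have h2 : deriv (fun x => deriv f (x + c)) = fun x => deriv (deriv f) (x + c) :=
    funext fun x => deriv_comp_add_const ..
  filter_upwards [hper, ae_comp_add_const hf.2 c] with x hx h
  rw [h1, h2, ← h, hx]

/-- For a `𝒫𝒯`-symmetric potential, `x ↦ conj (f (-x))` carries solutions for the spectral
parameter `E` to solutions for `conj E`. -/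
theorem IsSolution.conj_comp_neg (hPT : ∀ᵐ x : ℝ, conj (V (-x)) = V x)
    (hf : IsSolution V E f) : IsSolution V (conj E) (fun x => conj (f (-x))) := by
  refine ⟨hf.1.conj_comp_neg, ?_⟩
  filter_upwards [hPT, ae_comp_neg hf.2] with x hx h
  rw [deriv_deriv_conj_comp_neg, ← hx, ← map_mul, ← map_mul, ← h]
  simp

theorem IsSolutionWith.conj_comp_neg (hPT : ∀ᵐ x : ℝ, conj (V (-x)) = V x)
    (hf : IsSolutionWith V E a b f) :
    IsSolutionWith V (conj E) (conj a) (-conj b) (fun x => conj (f (-x))) := by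
  refine ⟨hf.1.conj_comp_neg hPT, by simp [hf.2.1], ?_⟩
  rw [deriv_conj_comp_neg]
  simp [hf.2.2]

/-- The Wronskian of two solutions for the same spectral parameter is constant. -/
theorem IsSolution.wronskian_eq (hf : IsSolution V E f) (hg : IsSolution V E g) (x y : ℝ) :
    f x * deriv g x - deriv f x * g x = f y * deriv g y - deriv f y * g y := by
  have hW : LocallyAC (fun x => f x * deriv g x - deriv f x * g x) :=
    (hf.1.locallyAC.mul hg.1.locallyAC_deriv).sub (hf.1.locallyAC_deriv.mul hg.1.locallyAC)
  refine hW.eq_of_ae_hasDerivAt_zero ?_ x y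
  filter_upwards [hf.2, hg.2, hf.1.locallyAC_deriv.ae_differentiableAt,
    hg.1.locallyAC_deriv.ae_differentiableAt] with x h1 h2 d1 d2
  have h := ((hf.1.differentiable x).hasDerivAt.mul d2.hasDerivAt).sub
    (d1.hasDerivAt.mul (hg.1.differentiable x).hasDerivAt)
  refine h.congr_deriv ?_
  linear_combination g x * h1 - f x * h2

/-- Uniqueness in the initial value problem, from a fundamental system: a solution with vanishing
initial data has vanishing Wronskian with both members of the system. -/
theorem IsSolutionWith.eq_of_fundamental {p q : ℝ → ℂ} (hp : IsSolutionWith V E 1 0 p)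
    (hq : IsSolutionWith V E 0 1 q) (hf : IsSolutionWith V E a b f) : f = a • p + b • q := by
  funext x
  have h1 := hp.1.wronskian_eq hq.1 x 0
  have h2 := hf.1.wronskian_eq hp.1 x 0
  have h3 := hf.1.wronskian_eq hq.1 x 0
  rw [hp.2.1, hp.2.2, hq.2.1, hq.2.2] at h1
  rw [hp.2.1, hp.2.2, hf.2.1, hf.2.2] at h2
  rw [hf.2.1, hf.2.2, hq.2.1, hq.2.2] at h3
  simp only [Pi.add_apply, Pi.smul_apply, smul_eq_mul]
  linear_combination (-f x) * h1 - q x * h2 + p x * h3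

end Hill

/-! ### The Volterra operator of the first-order system -/

namespace Hill

open scoped BoundedContinuousFunction
open Set

theorem _root_.AbsolutelyContinuousOnInterval.contDiff_comp {f h : ℝ → ℝ} {a b : ℝ}
    (hf : AbsolutelyContinuousOnInterval f a b) (hh : ContDiff ℝ 1 h) :
    AbsolutelyContinuousOnInterval (fun x => h (f x)) a b := by
  obtain ⟨C, hC⟩ := hf.exists_bound
  obtain ⟨K, hK⟩ := hh.contDiffOn.exists_lipschitzOnWith (s := Icc (-C) C) (by decide)
    (convex_Icc _ _) isCompact_Icc
  have hm : ∀ x ∈ uIcc a b, f x ∈ Icc (-C) C := fun x hx => abs_le.1 (hC x hx)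
  refine squeeze_zero' (.of_forall fun _ => Finset.sum_nonneg fun _ _ => dist_nonneg) ?_
    (hf.const_smul (K : ℝ))
  refine Filter.mem_inf_of_right (Filter.mem_principal.2 fun D hD => ?_)
  rw [Set.mem_ofPred_eq]
  refine Finset.sum_le_sum fun i hi => ?_
  refine (hK.dist_le_mul _ (hm _ (hD.1 i hi).1) _ (hm _ (hD.1 i hi).2)).trans ?_
  rw [dist_smul₀, NNReal.norm_eq]

/-- The weight `cosh (2 ∫₀ˣ a)`. It is chosen so that `|∫₀ˣ a w| ≤ w x / 2` on both sides of the
origin; this makes Volterra operators dominated by `a` contractions in the weighted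
supremum norm. -/
noncomputable def weight (a : ℝ → ℝ) (x : ℝ) : ℝ := Real.cosh (2 * ∫ t in (0 : ℝ)..x, a t)

variable {a : ℝ → ℝ}

theorem one_le_weight (a : ℝ → ℝ) (x : ℝ) : 1 ≤ weight a x := Real.one_le_cosh _

theorem weight_pos (a : ℝ → ℝ) (x : ℝ) : 0 < weight a x := Real.cosh_pos _

theorem continuous_weight (ha : LocallyIntegrable a volume) : Continuous (weight a) :=
  Real.continuous_cosh.comp
    (continuous_const.mul (intervalIntegral.continuous_primitive ha.intervalIntegrable' 0))

theorem locallyIntegrable_mul_weight (ha : LocallyIntegrable a volume) :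
    LocallyIntegrable (fun t => a t * weight a t) volume :=
  ha.mul_continuous (continuous_weight ha)

theorem integral_mul_weight (ha : LocallyIntegrable a volume) (x : ℝ) :
    ∫ t in (0 : ℝ)..x, a t * weight a t = Real.sinh (2 * ∫ t in (0 : ℝ)..x, a t) / 2 := by
  have hac : AbsolutelyContinuousOnInterval
      (fun x => Real.sinh (2 * ∫ t in (0 : ℝ)..x, a t)) 0 x :=
    ((ha.intervalIntegrable' 0 x).absolutelyContinuousOnInterval_intervalIntegral
      left_mem_uIcc).contDiff_comp (h := fun y => Real.sinh (2 * y))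
      (Real.contDiff_sinh.comp (contDiff_const.mul contDiff_id))
  have h := hac.integral_deriv_eq_sub
  rw [intervalIntegral.integral_congr_ae (g := fun t => 2 * (a t * weight a t)),
    intervalIntegral.integral_const_mul] at h
  · simp only [intervalIntegral.integral_same, mul_zero, Real.sinh_zero, sub_zero] at h
    rw [← h]
    ring
  · filter_upwards [LocallyIntegrable.ae_hasDerivAt_integral ha] with t ht _
    rw [((ht 0).const_mul 2).sinh.deriv, weight]
    ring

theorem abs_integral_mul_weight_le (ha : LocallyIntegrable a volume) (x : ℝ) :
    |∫ t in (0 : ℝ)..x, a t * weight a t| ≤ weight a x / 2 := by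
  rw [integral_mul_weight ha, abs_div, abs_two, weight, Real.abs_sinh, ← Real.cosh_abs]
  gcongr
  exact (Real.sinh_lt_cosh _).le

/-- The right-hand side `(p y₂, q y₁)` of the system `y₁' = p y₂`, `y₂' = q y₁`. -/
noncomputable def systemRhs (p q : ℝ → ℂ) (y : ℝ → ℂ × ℂ) (t : ℝ) : ℂ × ℂ := (p t * (y t).2, q t * (y t).1)

theorem locallyIntegrable_systemRhs {p q : ℝ → ℂ} (hp : LocallyIntegrable p volume)
    (hq : LocallyIntegrable q volume) {y : ℝ → ℂ × ℂ} (hy : Continuous y) :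
    LocallyIntegrable (systemRhs p q y) volume := by
  have h1 := hp.mul_continuous hy.snd
  have h2 := hq.mul_continuous hy.fst
  intro x
  obtain ⟨s, hs, i1⟩ := h1 x
  obtain ⟨t, ht, i2⟩ := h2 x
  exact ⟨s ∩ t, Filter.inter_mem hs ht, (i1.mono_set inter_subset_left).prodMk
    (i2.mono_set inter_subset_right)⟩

/-- `f ↦ w⁻¹ ∫₀ˣ (p w f₂, q w f₁)`, the Volterra operator of `y₁' = p y₂`, `y₂' = q y₁` conjugated
by the weight `w = weight a`. -/
noncomputable def volterraFun (a : ℝ → ℝ) (p q : ℝ → ℂ) (f : ℝ → ℂ × ℂ) (x : ℝ) : ℂ × ℂ :=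
  (weight a x)⁻¹ • ∫ t in (0 : ℝ)..x, systemRhs p q (fun s => weight a s • f s) t

theorem norm_volterraFun_le (ha : LocallyIntegrable a volume) {p q : ℝ → ℂ}
    (hpa : ∀ t, ‖p t‖ ≤ a t) (hqa : ∀ t, ‖q t‖ ≤ a t) (f : ℝ →ᵇ ℂ × ℂ) (x : ℝ) :
    ‖volterraFun a p q f x‖ ≤ 1 / 2 * ‖f‖ := by
  have hw := weight_pos a
  have hle : ∀ t, ‖systemRhs p q (fun s => weight a s • f s) t‖ ≤ a t * weight a t * ‖f‖ := by
    intro t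
    have hf : ‖weight a t • f t‖ ≤ weight a t * ‖f‖ := by
      rw [norm_smul, Real.norm_of_nonneg (hw t).le]
      exact mul_le_mul_of_nonneg_left (f.norm_coe_le_norm t) (hw t).le
    have h0 : 0 ≤ a t := (norm_nonneg _).trans (hpa t)
    rw [systemRhs, Prod.norm_def, norm_mul, norm_mul, mul_assoc]
    exact max_le
      (mul_le_mul (hpa t) ((norm_snd_le _).trans hf) (norm_nonneg _) h0)
      (mul_le_mul (hqa t) ((norm_fst_le _).trans hf) (norm_nonneg _) h0)
  have hint : ‖∫ t in (0 : ℝ)..x, systemRhs p q (fun s => weight a s • f s) t‖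
      ≤ weight a x / 2 * ‖f‖ := by
    refine (intervalIntegral.norm_integral_le_abs_of_norm_le (.of_forall fun t => hle t)
      (((locallyIntegrable_mul_weight ha).intervalIntegrable' 0 x).mul_const _)).trans ?_
    rw [intervalIntegral.integral_mul_const, abs_mul, abs_of_nonneg (norm_nonneg f)]
    exact mul_le_mul_of_nonneg_right (abs_integral_mul_weight_le ha x) (norm_nonneg _)
  rw [volterraFun, norm_smul, norm_inv, Real.norm_of_nonneg (hw x).le, inv_mul_le_iff₀ (hw x)]
  linarith

theorem intervalIntegrable_systemRhs_weight (ha : LocallyIntegrable a volume) {p q : ℝ → ℂ}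
    (hp : LocallyIntegrable p volume) (hq : LocallyIntegrable q volume) (f : ℝ →ᵇ ℂ × ℂ)
    (x y : ℝ) :
    IntervalIntegrable (systemRhs p q (fun s => weight a s • f s)) volume x y :=
  (locallyIntegrable_systemRhs hp hq
    ((continuous_weight ha).smul f.continuous)).intervalIntegrable' x y

theorem continuous_volterraFun (ha : LocallyIntegrable a volume) {p q : ℝ → ℂ}
    (hp : LocallyIntegrable p volume) (hq : LocallyIntegrable q volume) (f : ℝ →ᵇ ℂ × ℂ) :
    Continuous (volterraFun a p q f) :=
  ((continuous_weight ha).inv₀ fun x => (weight_pos a x).ne').smul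
    (intervalIntegral.continuous_primitive
      (intervalIntegrable_systemRhs_weight ha hp hq f) 0)

/-- The weighted Volterra operator `volterraFun` as a bounded operator on the bounded continuous
functions, for coefficients dominated by `a`. -/
noncomputable def volterra (ha : LocallyIntegrable a volume) {p q : ℝ → ℂ} (hp : LocallyIntegrable p volume)
    (hq : LocallyIntegrable q volume) (hpa : ∀ t, ‖p t‖ ≤ a t) (hqa : ∀ t, ‖q t‖ ≤ a t) :
    (ℝ →ᵇ ℂ × ℂ) →L[ℂ] (ℝ →ᵇ ℂ × ℂ) :=
  LinearMap.mkContinuous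
    { toFun := fun f => BoundedContinuousFunction.ofNormedAddCommGroup (volterraFun a p q f)
        (continuous_volterraFun ha hp hq f) (1 / 2 * ‖f‖) (norm_volterraFun_le ha hpa hqa f)
      map_add' := by
        intro f g
        ext1 x
        change volterraFun a p q (f + g) x = volterraFun a p q f x + volterraFun a p q g x
        simp only [volterraFun]
        rw [← smul_add, ← intervalIntegral.integral_add
          (intervalIntegrable_systemRhs_weight ha hp hq f _ _)
          (intervalIntegrable_systemRhs_weight ha hp hq g _ _)]
        congr 2
        funext t
        ext <;> simp [systemRhs, mul_add]
      map_smul' := by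
        intro c f
        ext1 x
        change volterraFun a p q (c • f) x = c • volterraFun a p q f x
        simp only [volterraFun]
        rw [smul_comm c, ← intervalIntegral.integral_smul c]
        congr 2
        funext t
        ext <;> simp [systemRhs] <;> ring }
    (1 / 2) fun f => BoundedContinuousFunction.norm_ofNormedAddCommGroup_le
      (continuous_volterraFun ha hp hq f) (by positivity) (norm_volterraFun_le ha hpa hqa f)

theorem volterra_apply (ha : LocallyIntegrable a volume) {p q : ℝ → ℂ}
    (hp : LocallyIntegrable p volume) (hq : LocallyIntegrable q volume)
    (hpa : ∀ t, ‖p t‖ ≤ a t) (hqa : ∀ t, ‖q t‖ ≤ a t) (f : ℝ →ᵇ ℂ × ℂ) (x : ℝ) :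
    volterra ha hp hq hpa hqa f x = volterraFun a p q f x := rfl

theorem norm_volterra_le (ha : LocallyIntegrable a volume) {p q : ℝ → ℂ}
    (hp : LocallyIntegrable p volume) (hq : LocallyIntegrable q volume)
    (hpa : ∀ t, ‖p t‖ ≤ a t) (hqa : ∀ t, ‖q t‖ ≤ a t) :
    ‖volterra ha hp hq hpa hqa‖ ≤ 1 / 2 :=
  LinearMap.mkContinuous_norm_le _ (by norm_num) _

theorem differentiableAt_inverse_one_sub {X Y : Type*} [NormedAddCommGroup X] [NormedSpace ℂ X]
    [CompleteSpace X] [NormedAddCommGroup Y] [NormedSpace ℂ Y] {A B : X →L[ℂ] X} {E : ℂ}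
    (h : ‖A - E • B‖ < 1) (g : X) (l : X →L[ℂ] Y) :
    DifferentiableAt ℂ (fun E : ℂ => l (Ring.inverse (1 - (A - E • B)) g)) E := by
  have h1 : DifferentiableAt ℂ (fun E : ℂ => 1 - (A - E • B)) E := by fun_prop
  have h2 : DifferentiableAt ℂ (fun E : ℂ => Ring.inverse (1 - (A - E • B))) E :=
    DifferentiableAt.comp (g := Ring.inverse) E
      (differentiableAt_inverse (Units.oneSub (A - E • B) h).isUnit) h1
  exact l.differentiableAt.comp E (h2.clm_apply (differentiableAt_const g))

/-- The system `y₁' = y₂`, `y₂' = (V - E) y₁` has a solution with prescribed initial value `c`,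
depending holomorphically on `E`: it is `w • (1 - K_E)⁻¹ (w⁻¹ • c)` where `w` is the weight and the
Volterra operator `K_E` is affine in `E` with norm at most `1 / 2`. -/
theorem exists_differentiableOn_system {V : ℝ → ℂ} (hV : LocallyIntegrable V volume)
    (c : ℂ × ℂ) (R : ℝ) (hR : 0 ≤ R) :
    ∃ Y : ℂ → ℝ → ℂ × ℂ,
      (∀ E ∈ Metric.ball (0 : ℂ) R, Continuous (Y E) ∧
        ∀ x, Y E x = c + ∫ t in (0 : ℝ)..x, systemRhs (fun _ => 1) (fun t => V t - E) (Y E) t) ∧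
      ∀ x, DifferentiableOn ℂ (fun E => Y E x) (Metric.ball 0 R) := by
  set a : ℝ → ℝ := fun t => 1 + ‖V t‖ + R with ha_def
  have hVn : LocallyIntegrable (fun t => ‖V t‖) volume := fun x =>
    let ⟨s, hs, h⟩ := hV x; ⟨s, hs, h.norm⟩
  have ha : LocallyIntegrable a volume :=
    ((locallyIntegrable_const 1).add hVn).add (locallyIntegrable_const R)
  have i0 : LocallyIntegrable (fun _ : ℝ => (0 : ℂ)) volume := locallyIntegrable_const 0
  have i1 : LocallyIntegrable (fun _ : ℝ => (1 : ℂ)) volume := locallyIntegrable_const 1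
  have b0 : ∀ t, ‖(0 : ℂ)‖ ≤ a t := fun t => by simp only [ha_def, norm_zero]; positivity
  have b1 : ∀ t, ‖(1 : ℂ)‖ ≤ a t := fun t => by
    simp only [ha_def, norm_one]; linarith [norm_nonneg (V t)]
  have bV : ∀ t, ‖V t‖ ≤ a t := fun t => by simp only [ha_def]; linarith
  let A := volterra ha i1 hV b1 bV
  let B := volterra ha i0 i1 b0 b1
  have hK : ∀ E ∈ Metric.ball (0 : ℂ) R, ∀ (f : ℝ →ᵇ ℂ × ℂ) x,
      (A - E • B) f x = volterraFun a (fun _ => 1) (fun t => V t - E) f x := by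
    intro E hE f x
    have hc : Continuous fun s => weight a s • f s :=
      (continuous_weight ha).smul f.continuous
    have hiV := (locallyIntegrable_systemRhs i1 hV hc).intervalIntegrable' 0 x
    have hi1 := (locallyIntegrable_systemRhs i0 i1 hc).intervalIntegrable' 0 x
    change volterraFun a (fun _ => 1) V f x - E • volterraFun a (fun _ => 0) (fun _ => 1) f x = _
    rw [volterraFun, volterraFun, volterraFun, smul_comm E, ← smul_sub,
      ← intervalIntegral.integral_smul, ← intervalIntegral.integral_sub hiV
        (g := fun t => E • systemRhs (fun _ => 0) (fun _ => 1) (fun s => weight a s • f s) t)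
        (hi1.smul E)]
    congr 2
    funext t
    ext <;> simp [systemRhs, sub_mul]
  have hnorm : ∀ E ∈ Metric.ball (0 : ℂ) R, ‖A - E • B‖ < 1 := by
    intro E hE
    have iE : LocallyIntegrable (fun t => V t - E) volume :=
      hV.sub (locallyIntegrable_const E)
    have bE : ∀ t, ‖V t - E‖ ≤ a t := fun t => by
      have := norm_sub_le (V t) E
      rw [mem_ball_zero_iff] at hE
      simp only [ha_def]; linarith
    have : A - E • B = volterra ha i1 iE b1 bE := by
      ext1 f
      ext1 x
      rw [hK E hE, volterra_apply]
    rw [this]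
    exact (norm_volterra_le ..).trans_lt (by norm_num)
  have hunit : ∀ E ∈ Metric.ball (0 : ℂ) R, IsUnit (1 - (A - E • B)) := fun E hE =>
    (Units.oneSub (A - E • B) (hnorm E hE)).isUnit
  have hwi : ∀ x, ‖(weight a x)⁻¹ • c‖ ≤ ‖c‖ := fun x => by
    rw [norm_smul, norm_inv, Real.norm_of_nonneg (weight_pos a x).le]
    exact mul_le_of_le_one_left (norm_nonneg _) (inv_le_one_of_one_le₀ (one_le_weight a x))
  let g : ℝ →ᵇ ℂ × ℂ := BoundedContinuousFunction.ofNormedAddCommGroup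
    (fun x => (weight a x)⁻¹ • c)
    (((continuous_weight ha).inv₀ fun x => (weight_pos a x).ne').smul continuous_const) ‖c‖ hwi
  let F : ℂ → ℝ →ᵇ ℂ × ℂ := fun E => Ring.inverse (1 - (A - E • B)) g
  refine ⟨fun E x => weight a x • F E x, fun E hE => ⟨?_, fun x => ?_⟩, fun x E hE => ?_⟩
  · exact (continuous_weight ha).smul (F E).continuous
  · have h : (1 - (A - E • B)) (F E) = g := by
      change ((1 - (A - E • B)) * Ring.inverse (1 - (A - E • B))) g = g
      rw [Ring.mul_inverse_cancel _ (hunit E hE)]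
      rfl
    have hx : F E x - (A - E • B) (F E) x = (weight a x)⁻¹ • c := congrArg (fun f => f x) h
    rw [hK E hE, sub_eq_iff_eq_add] at hx
    simp only
    rw [hx, smul_add, smul_inv_smul₀ (weight_pos a x).ne', volterraFun,
      smul_inv_smul₀ (weight_pos a x).ne']
  · have h3 : DifferentiableAt ℂ (fun E => F E x) E :=
      differentiableAt_inverse_one_sub (hnorm E hE) g (BoundedContinuousFunction.evalCLM ℂ x)
    exact (h3.const_smul (weight a x)).differentiableWithinAt

end Hill

/-! ### The initial value problem and the discriminant -/

namespace Hill

variable {V : ℝ → ℂ} {E a b : ℂ} {ω : ℝ}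

theorem isSolutionWith_of_system (hV : LocallyIntegrable V volume) {c : ℂ × ℂ}
    {Y : ℝ → ℂ × ℂ} (hY : Continuous Y)
    (h : ∀ x, Y x = c + ∫ t in (0 : ℝ)..x, systemRhs (fun _ => 1) (fun t => V t - E) Y t) :
    IsSolutionWith V E c.1 c.2 (fun x => (Y x).1) ∧
      deriv (fun x => (Y x).1) = fun x => (Y x).2 := by
  have iE : LocallyIntegrable (fun t => V t - E) volume := hV.sub (locallyIntegrable_const E)
  have hI := (locallyIntegrable_systemRhs (p := fun _ => 1) (locallyIntegrable_const 1) iE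
    hY).intervalIntegrable'
  have h1 : ∀ x, (Y x).1 = c.1 + ∫ t in (0 : ℝ)..x, (Y t).2 := fun x => by
    have := (ContinuousLinearMap.fst ℝ ℂ ℂ).intervalIntegral_comp_comm (hI 0 x)
    rw [h x, Prod.fst_add]
    refine congrArg (c.1 + ·) (this.symm.trans ?_)
    simp [systemRhs]
  have h2 : ∀ x, (Y x).2 = c.2 + ∫ t in (0 : ℝ)..x, (V t - E) * (Y t).1 := fun x => by
    have := (ContinuousLinearMap.snd ℝ ℂ ℂ).intervalIntegral_comp_comm (hI 0 x)
    rw [h x, Prod.snd_add]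
    exact congrArg (c.2 + ·) this.symm
  have hd : ∀ x, HasDerivAt (fun x => (Y x).1) (Y x).2 x := fun x => by
    rw [funext h1]
    exact (intervalIntegral.integral_hasDerivAt_right (hY.snd.intervalIntegrable _ _)
      (hY.snd.stronglyMeasurableAtFilter _ _) hY.snd.continuousAt).const_add c.1
  have hderiv : deriv (fun x => (Y x).1) = fun x => (Y x).2 := funext fun x => (hd x).deriv
  have hloc : LocallyIntegrable (fun t => (V t - E) * (Y t).1) volume :=
    iE.mul_continuous hY.fst
  refine ⟨⟨⟨⟨?_, fun x => (hd x).differentiableAt, ?_⟩, ?_⟩, ?_, ?_⟩, hderiv⟩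
  · rw [funext h1]
    exact locallyAC_const_add_primitive hY.snd.locallyIntegrable _
  · rw [hderiv, funext h2]
    exact locallyAC_const_add_primitive hloc _
  · rw [hderiv, funext h2]
    filter_upwards [LocallyIntegrable.ae_hasDerivAt_integral hloc] with x hx
    rw [((hx 0).const_add c.2).deriv]
    ring
  · simp [h1 0]
  · simp [hderiv, h2 0]

theorem exists_isSolutionWith (hV : LocallyIntegrable V volume) (E a b : ℂ) :
    ∃ f, IsSolutionWith V E a b f := by
  obtain ⟨Y, h, -⟩ := exists_differentiableOn_system hV (a, b) (‖E‖ + 1) (by positivity)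
  obtain ⟨h1, h2⟩ := h E (by simp)
  exact ⟨_, (isSolutionWith_of_system hV h1 h2).1⟩

theorem IsSolutionWith.unique (hV : LocallyIntegrable V volume) {f g : ℝ → ℂ}
    (hf : IsSolutionWith V E a b f) (hg : IsSolutionWith V E a b g) : f = g := by
  obtain ⟨p, hp⟩ := exists_isSolutionWith hV E 1 0
  obtain ⟨q, hq⟩ := exists_isSolutionWith hV E 0 1
  exact (hp.eq_of_fundamental hq hf).trans (hp.eq_of_fundamental hq hg).symm

theorem isSolutionWith_solution (hV : LocallyIntegrable V volume) (E a b : ℂ) :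
    IsSolutionWith V E a b (solution V E a b) :=
  Classical.epsilon_spec (exists_isSolutionWith hV E a b)

/-- The Cauchy data of the solution with fixed initial values are entire functions of `E`. -/
theorem differentiable_solution (hV : LocallyIntegrable V volume) (a b : ℂ) (x : ℝ) :
    Differentiable ℂ (fun E => solution V E a b x) ∧
      Differentiable ℂ (fun E => deriv (solution V E a b) x) := by
  have key : ∀ E₀ : ℂ, DifferentiableAt ℂ (fun E => solution V E a b x) E₀ ∧
      DifferentiableAt ℂ (fun E => deriv (solution V E a b) x) E₀ := by
    intro E₀
    obtain ⟨Y, h, hd⟩ := exists_differentiableOn_system hV (a, b) (‖E₀‖ + 1) (by positivity)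
    have hnhds : Metric.ball (0 : ℂ) (‖E₀‖ + 1) ∈ nhds E₀ :=
      Metric.isOpen_ball.mem_nhds (by simp)
    have heq : ∀ E ∈ Metric.ball (0 : ℂ) (‖E₀‖ + 1),
        solution V E a b = (fun x => (Y E x).1) ∧
          deriv (solution V E a b) = fun x => (Y E x).2 := by
      intro E hE
      obtain ⟨h1, h2⟩ := isSolutionWith_of_system hV (h E hE).1 (h E hE).2
      have := (isSolutionWith_solution hV E a b).unique hV h1
      exact ⟨this, by rw [this, h2]⟩
    have hY := (hd x).differentiableAt hnhds
    exact ⟨hY.fst.congr_of_eventuallyEq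
        (Filter.eventually_of_mem hnhds fun E hE => congrFun (heq E hE).1 x),
      hY.snd.congr_of_eventuallyEq
        (Filter.eventually_of_mem hnhds fun E hE => congrFun (heq E hE).2 x)⟩
  exact ⟨fun E => (key E).1, fun E => (key E).2⟩

theorem discriminant_eq (V : ℝ → ℂ) (ω : ℝ) (E : ℂ) :
    discriminant V ω E = (phi₁ V E ω + deriv (phi₂ V E) ω) / 2 := by
  simp [discriminant, monodromy, Matrix.trace_fin_two]

theorem differentiable_discriminant (hV : LocallyIntegrable V volume) (ω : ℝ) :
    Differentiable ℂ (discriminant V ω) := by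
  rw [funext (discriminant_eq V ω)]
  exact ((differentiable_solution hV 1 0 ω).1.add
    (differentiable_solution hV 0 1 ω).2).div_const 2

/-- The Wronskian of `φ₁(· - ω)` and `φ₂`, evaluated at `0` and at `ω`. -/
theorem phi₁_neg_period (hV : LocallyIntegrable V volume)
    (hper : ∀ᵐ x : ℝ, V (x + ω) = V x) (E : ℂ) :
    phi₁ V E (-ω) = deriv (phi₂ V E) ω := by
  have h1 : IsSolutionWith V E 1 0 (phi₁ V E) := isSolutionWith_solution hV E 1 0
  have h2 : IsSolutionWith V E 0 1 (phi₂ V E) := isSolutionWith_solution hV E 0 1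
  have hper' : ∀ᵐ x : ℝ, V (x + -ω) = V x := by
    filter_upwards [ae_comp_add_const hper (-ω)] with x hx
    rw [← hx, neg_add_cancel_right]
  have hw := (h1.1.comp_add_const hper').wronskian_eq h2.1 0 ω
  rw [deriv_comp_add_const, deriv_comp_add_const] at hw
  simpa [h1.2.1, h1.2.2, h2.2.1, h2.2.2] using hw

theorem discriminant_im_eq_zero (hV : LocallyIntegrable V volume)
    (hper : ∀ᵐ x : ℝ, V (x + ω) = V x) (hPT : ∀ᵐ x : ℝ, conj (V (-x)) = V x) (E : ℝ) :
    (discriminant V ω E).im = 0 := by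
  have h1 : IsSolutionWith V E 1 0 (phi₁ V E) := isSolutionWith_solution hV E 1 0
  have h2 : IsSolutionWith V E 1 0 (fun x => conj (phi₁ V E (-x))) := by
    simpa using h1.conj_comp_neg hPT
  have h := congrFun (h1.unique hV h2) ω
  rw [discriminant_eq, h, phi₁_neg_period hV hper]
  simp

/-! ### Bloch solutions -/

/-- If the discriminant takes a real value in `[-1, 1]`, the monodromy matrix, which has
determinant `1`, has an eigenvalue of modulus `1`, and its eigenvector gives a Bloch solution. -/
theorem exists_bloch_solution (hV : LocallyIntegrable V volume)
    (hper : ∀ᵐ x : ℝ, V (x + ω) = V x) {t : ℝ} (ht : discriminant V ω E = t) (h1 : -1 ≤ t)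
    (h2 : t ≤ 1) :
    ∃ (ρ : ℂ) (f : ℝ → ℂ), ‖ρ‖ = 1 ∧ IsSolution V E f ∧ f ≠ 0 ∧ ∀ x, f (x + ω) = ρ * f x := by
  have s1 : IsSolutionWith V E 1 0 (phi₁ V E) := isSolutionWith_solution hV E 1 0
  have s2 : IsSolutionWith V E 0 1 (phi₂ V E) := isSolutionWith_solution hV E 0 1
  have hsq : 0 ≤ 1 - t ^ 2 := by nlinarith
  -- the eigenvalue is the root `t + i √(1 - t²)` of the characteristic polynomial `ρ² - 2 t ρ + 1`
  set r := Real.sqrt (1 - t ^ 2) with hr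
  have hrr : r ^ 2 = 1 - t ^ 2 := Real.sq_sqrt hsq
  have hrr' : (r : ℂ) ^ 2 = 1 - (t : ℂ) ^ 2 := by exact_mod_cast hrr
  obtain ⟨ρ, hρ⟩ : ∃ ρ : ℂ, ρ = t + r * Complex.I := ⟨_, rfl⟩
  have hnorm : ‖ρ‖ = 1 := by
    rw [hρ, Complex.norm_add_mul_I, hrr]
    simp
  have hquad : ρ ^ 2 - 2 * t * ρ + 1 = 0 := by
    rw [hρ]
    linear_combination (-1 : ℂ) * hrr' + (r : ℂ) ^ 2 * Complex.I_sq
  have hdet : phi₁ V E ω * deriv (phi₂ V E) ω - deriv (phi₁ V E) ω * phi₂ V E ω = 1 := by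
    rw [s1.1.wronskian_eq s2.1 ω 0, s1.2.1, s1.2.2, s2.2.1, s2.2.2]
    ring
  rw [discriminant_eq] at ht
  obtain ⟨v, hv, hMv⟩ := Matrix.exists_mulVec_eq_zero_iff.2
    (show (monodromy V ω E - Matrix.scalar (Fin 2) ρ).det = 0 by
      rw [Matrix.det_fin_two]
      simp [monodromy]
      linear_combination hdet + hquad - 2 * ρ * ht)
  have e0 := congrFun hMv 0
  have e1 := congrFun hMv 1
  simp [monodromy, Matrix.mulVec, dotProduct, Fin.sum_univ_two] at e0 e1
  have hf := s1.linearCombination s2 (v 0) (v 1)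
  simp only [mul_one, mul_zero, add_zero, zero_add] at hf
  set f := v 0 • phi₁ V E + v 1 • phi₂ V E with hf_def
  refine ⟨ρ, f, hnorm, hf.1, fun h0 => hv ?_, fun x => ?_⟩
  · have a0 := hf.2.1
    have a1 := hf.2.2
    rw [h0] at a0 a1
    have hd : deriv (0 : ℝ → ℂ) = 0 := by ext; simp
    rw [hd] at a1
    funext i
    fin_cases i
    · simpa using a0.symm
    · simpa using a1.symm
  · -- both sides solve the equation with the same initial values, as `v` is an eigenvector
    have g1 : IsSolutionWith V E (ρ * v 0) (ρ * v 1) (fun x => f (x + ω)) := by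
      refine ⟨hf.1.comp_add_const hper, ?_, ?_⟩
      · simp only [zero_add, hf_def, Pi.add_apply, Pi.smul_apply, smul_eq_mul]
        linear_combination e0
      · rw [deriv_comp_add_const, zero_add, hf_def,
          (s1.1.1.smul _).deriv_add (s2.1.1.smul _), s1.1.1.deriv_smul, s2.1.1.deriv_smul]
        simp only [Pi.add_apply, Pi.smul_apply, smul_eq_mul]
        linear_combination e1
    have g2 : IsSolutionWith V E (ρ * v 0) (ρ * v 1) (ρ • f) := by
      refine ⟨hf.1.smul ρ, by simp [hf.2.1], ?_⟩
      rw [hf.1.1.deriv_smul]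
      simp [hf.2.2]
    exact congrFun (g1.unique hV g2) x

end Hill

/-! ### Bounded solutions and the spectrum -/

namespace Hill

variable {V : ℝ → ℂ} {E : ℂ}

theorem norm_sq_eq_integral (f : L2) {g : ℝ → ℂ} (h : f =ᵐ[volume] g) :
    ‖f‖ ^ 2 = ∫ x, ‖g x‖ ^ 2 := by
  have h1 : ((‖f‖ ^ 2 : ℝ) : ℂ) = ((∫ x, ‖g x‖ ^ 2 : ℝ) : ℂ) := by
    have := inner_self_eq_norm_sq_to_K (𝕜 := ℂ) f
    rw [L2.inner_def] at this
    rw [← integral_complex_ofReal]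
    push_cast
    refine Eq.trans this.symm (integral_congr_ae ?_)
    filter_upwards [h] with x hx
    rw [hx, inner_self_eq_norm_sq_to_K]
    rfl
  exact_mod_cast h1

theorem coe_hillOperator_ae (f : domain V) {g : ℝ → ℂ} (hg : Regular g)
    (h : (f : L2) =ᵐ[volume] g) : hillOperator V f =ᵐ[volume] expr V g := by
  have := (rep_spec f).2.2.coeFn_toLp
  rw [← rep_unique f hg h]
  exact this

section Cutoff

variable {χ g : ℝ → ℂ}

theorem deriv_mul_regular (hχ : ContDiff ℝ 2 χ) (hg : Regular g) :
    deriv (fun x => χ x * g x) = fun x => deriv χ x * g x + χ x * deriv g x :=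
  funext fun x => ((hχ.differentiable (by norm_num) x).hasDerivAt.mul
    (hg.differentiable x).hasDerivAt).deriv

theorem contDiff_one_deriv (hχ : ContDiff ℝ 2 χ) : ContDiff ℝ 1 (deriv χ) :=
  (contDiff_succ_iff_deriv (n := 1)).1 hχ |>.2.2

theorem Regular.contDiff_mul (hχ : ContDiff ℝ 2 χ) (hg : Regular g) :
    Regular (fun x => χ x * g x) where
  locallyAC := (hχ.of_le (by norm_num)).locallyAC.mul hg.locallyAC
  differentiable := (hχ.differentiable (by norm_num)).mul hg.differentiable
  locallyAC_deriv := by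
    rw [deriv_mul_regular hχ hg]
    exact ((contDiff_one_deriv hχ).locallyAC.mul hg.locallyAC).add
      ((hχ.of_le (by norm_num)).locallyAC.mul hg.locallyAC_deriv)

theorem IsSolution.expr_contDiff_mul (hχ : ContDiff ℝ 2 χ) (hg : IsSolution V E g) :
    expr V (fun x => χ x * g x) =ᵐ[volume] fun x =>
      E * (χ x * g x) - (2 * deriv χ x * deriv g x + deriv (deriv χ) x * g x) := by
  filter_upwards [hg.2, hg.1.locallyAC_deriv.ae_differentiableAt] with x h hd
  have h1 := (hχ.differentiable (by norm_num) x).hasDerivAt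
  have h2 := ((contDiff_one_deriv hχ).differentiable (by norm_num) x).hasDerivAt
  have h3 := (hg.1.differentiable x).hasDerivAt
  rw [expr, deriv_mul_regular hχ hg.1, ((h2.fun_mul h3).fun_add (h1.fun_mul hd.hasDerivAt)).deriv]
  linear_combination χ x * h

/-- Cutting off a solution gives a function in the domain whose image under `H - E` only involves
derivatives of the cutoff. -/
theorem norm_cutoff_le {R : L2 →L[ℂ] L2}
    (hR : ∀ f : (hillOperator V).domain, R (hillOperator V f - E • (f : L2)) = f)
    (hχ : ContDiff ℝ 2 χ) (hs : HasCompactSupport χ) (hg : IsSolution V E g) :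
    ∫ x, ‖χ x * g x‖ ^ 2 ≤
      ‖R‖ ^ 2 * ∫ x, ‖2 * deriv χ x * deriv g x + deriv (deriv χ) x * g x‖ ^ 2 := by
  have cg := hg.1.differentiable.continuous
  have cg' := hg.1.locallyAC_deriv.continuous
  have cχ' := (contDiff_one_deriv hχ).continuous
  have cχ'' := (contDiff_one_deriv hχ).continuous_deriv (by norm_num)
  have m1 : MemLp (fun x => χ x * g x) 2 volume :=
    (hχ.continuous.mul cg).memLp_of_hasCompactSupport hs.mul_right
  have m2 : MemLp (fun x => 2 * deriv χ x * deriv g x + deriv (deriv χ) x * g x) 2 volume :=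
    (((continuous_const.mul cχ').mul cg').add (cχ''.mul cg)).memLp_of_hasCompactSupport
      (hs.deriv.mul_left.mul_right.add hs.deriv.deriv.mul_right)
  have hreg := Regular.contDiff_mul hχ hg.1
  have hexp := hg.expr_contDiff_mul hχ
  let f : domain V := ⟨m1.toLp _, _, m1.coeFn_toLp, hreg,
    ((m1.const_mul E).sub m2).ae_eq hexp.symm⟩
  have hf : (f : L2) =ᵐ[volume] fun x => χ x * g x := m1.coeFn_toLp
  have hT : (hillOperator V f - E • (f : L2) : L2) =ᵐ[volume]
      fun x => -(2 * deriv χ x * deriv g x + deriv (deriv χ) x * g x) := by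
    filter_upwards [Lp.coeFn_sub (hillOperator V f) (E • (f : L2)),
      Lp.coeFn_smul E (f : L2), hf, coe_hillOperator_ae f hreg hf, hexp] with x e1 e2 e3 e4 e5
    rw [e1, Pi.sub_apply, e2, Pi.smul_apply, e3, e4, e5, smul_eq_mul]
    ring
  have hle := R.le_opNorm (hillOperator V f - E • (f : L2))
  rw [hR f] at hle
  have := pow_le_pow_left₀ (norm_nonneg _) hle 2
  rw [mul_pow, norm_sq_eq_integral _ hf, norm_sq_eq_integral _ hT] at this
  simpa only [norm_neg] using this

theorem exists_cutoff : ∃ η : ℝ → ℂ, ContDiff ℝ 2 η ∧ HasCompactSupport η ∧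
    (∀ x, |x| ≤ 1 → η x = 1) ∧ ∀ x, 2 < |x| → x ∉ tsupport η := by
  let φ : ContDiffBump (0 : ℝ) := ⟨1, 2, by norm_num, by norm_num⟩
  refine ⟨fun x => (φ x : ℂ), Complex.ofRealCLM.contDiff.comp φ.contDiff,
    φ.hasCompactSupport.comp_left (g := Complex.ofReal) rfl, fun x hx => ?_, fun x hx hmem => ?_⟩
  · beta_reduce
    rw [φ.one_of_mem_closedBall (by simpa using hx), Complex.ofReal_one]
  · have h1 : tsupport (fun x => (φ x : ℂ)) ⊆ tsupport φ :=
      closure_mono (Function.support_comp_subset (g := Complex.ofReal) rfl φ)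
    have := h1 hmem
    rw [φ.tsupport_eq, mem_closedBall_zero_iff, Real.norm_eq_abs] at this
    exact absurd this (not_le.2 hx)

end Cutoff

/-- If `g` is a solution with `g` and `g'` bounded and `g` not square integrable, then the
spectral parameter lies in the spectrum: the functions `η(x / N) g(x)`, with `η` a fixed bump, are
mapped by `H - E` to functions bounded in `L²`, while their norms tend to infinity. -/
theorem mem_spectrum_of_bounded_solution {g : ℝ → ℂ} (hg : IsSolution V E g) {C : ℝ}
    (hC : ∀ x, ‖g x‖ ≤ C) (hC' : ∀ x, ‖deriv g x‖ ≤ C)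
    (hinf : Filter.Tendsto (fun t => ∫ x in (0 : ℝ)..t, ‖g x‖ ^ 2) Filter.atTop Filter.atTop) :
    E ∈ spectrum (hillOperator V) := by
  rintro ⟨R, -, hR⟩
  obtain ⟨η, hη, hs, hone, hts⟩ := exists_cutoff
  have c1 := (contDiff_one_deriv hη).continuous
  have c2 := (contDiff_one_deriv hη).continuous_deriv (by norm_num)
  obtain ⟨D₁, hD₁⟩ := hs.deriv.exists_bound_of_continuous c1
  obtain ⟨D₂, hD₂⟩ := hs.deriv.deriv.exists_bound_of_continuous c2
  have hC0 : 0 ≤ C := (norm_nonneg _).trans (hC 0)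
  have hD₁0 : 0 ≤ D₁ := (norm_nonneg _).trans (hD₁ 0)
  have hD₂0 : 0 ≤ D₂ := (norm_nonneg _).trans (hD₂ 0)
  -- `K / N` bounds the commutator `2 χ' g' + χ'' g` for the cutoff `χ(x) = η(x / N)`, `N ≥ 1`; as
  -- its support has length at most `4 N`, its squared norm is at most `4 K ^ 2 / N ≤ 4 K ^ 2`
  set K := 2 * D₁ * C + D₂ * C with hK
  have hK0 : 0 ≤ K := by positivity
  have key : ∀ N : ℝ, 1 ≤ N → ∫ x in (0 : ℝ)..N, ‖g x‖ ^ 2 ≤ ‖R‖ ^ 2 * (4 * K ^ 2) := by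
    intro N hN
    have hN0 : 0 < N := by linarith
    obtain ⟨χ, hχ_def⟩ : ∃ χ : ℝ → ℂ, χ = fun x => η (N⁻¹ * x) := ⟨_, rfl⟩
    have hχ : ContDiff ℝ 2 χ := hχ_def ▸ hη.comp (contDiff_const.mul contDiff_id)
    have hχs : HasCompactSupport χ :=
      hχ_def ▸ hs.comp_homeomorph (Homeomorph.mulLeft₀ N⁻¹ (inv_ne_zero hN0.ne'))
    have d1 : deriv χ = fun x => N⁻¹ • deriv η (N⁻¹ * x) := by
      rw [hχ_def]
      exact funext fun x => deriv_comp_mul_left ..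
    have d2 : deriv (deriv χ) = fun x => N⁻¹ • N⁻¹ • deriv (deriv η) (N⁻¹ * x) := by
      rw [d1]
      funext x
      rw [deriv_fun_const_smul_field, deriv_comp_mul_left]
    have hle := norm_cutoff_le hR hχ hχs hg
    have hlow : ∫ x in (0 : ℝ)..N, ‖g x‖ ^ 2 ≤ ∫ x, ‖χ x * g x‖ ^ 2 := by
      have hcont : Continuous fun x => χ x * g x := hχ.continuous.mul hg.1.differentiable.continuous
      have hsupp : HasCompactSupport (fun x => χ x * g x) := hχs.mul_right
      have hint : Integrable (fun x => ‖χ x * g x‖ ^ 2) volume :=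
        (memLp_two_iff_integrable_sq_norm hcont.aestronglyMeasurable).1
          (hcont.memLp_of_hasCompactSupport hsupp)
      rw [intervalIntegral.integral_of_le hN0.le]
      refine le_trans (le_of_eq (setIntegral_congr_fun measurableSet_Ioc fun x hx => ?_))
        (setIntegral_le_integral hint (.of_forall fun x => by positivity))
      have : χ x = 1 := by
        rw [hχ_def]
        refine hone _ ?_
        rw [abs_of_nonneg (mul_nonneg (inv_nonneg.2 hN0.le) hx.1.le), inv_mul_le_iff₀ hN0,
          mul_one]
        exact hx.2
      simp [this]
    have hup : ∫ x, ‖2 * deriv χ x * deriv g x + deriv (deriv χ) x * g x‖ ^ 2 ≤ 4 * K ^ 2 := by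
      have hpt : ∀ x, ‖2 * deriv χ x * deriv g x + deriv (deriv χ) x * g x‖ ^ 2 ≤
          (Set.Icc (-(2 * N)) (2 * N)).indicator (fun _ => (N⁻¹ * K) ^ 2) x := by
        intro x
        by_cases hx : x ∈ Set.Icc (-(2 * N)) (2 * N)
        · rw [Set.indicator_of_mem hx]
          refine pow_le_pow_left₀ (norm_nonneg _) ?_ 2
          have hNi : N⁻¹ ≤ 1 := inv_le_one_of_one_le₀ hN
          have hNi0 : 0 ≤ N⁻¹ := inv_nonneg.2 hN0.le
          have b1 : ‖deriv χ x‖ ≤ N⁻¹ * D₁ := by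
            rw [d1, norm_smul, Real.norm_of_nonneg hNi0]
            exact mul_le_mul_of_nonneg_left (hD₁ _) hNi0
          have b2 : ‖deriv (deriv χ) x‖ ≤ N⁻¹ * D₂ := by
            rw [d2, norm_smul, norm_smul, Real.norm_of_nonneg hNi0]
            exact mul_le_mul_of_nonneg_left ((mul_le_of_le_one_left (norm_nonneg _) hNi).trans
              (hD₂ _)) hNi0
          calc _ ≤ ‖2 * deriv χ x * deriv g x‖ + ‖deriv (deriv χ) x * g x‖ := norm_add_le _ _
            _ ≤ 2 * (N⁻¹ * D₁) * C + N⁻¹ * D₂ * C := by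
              rw [norm_mul, norm_mul, norm_mul, RCLike.norm_two]
              gcongr
              · exact hC' x
              · exact hC x
            _ = N⁻¹ * K := by rw [hK]; ring
        · rw [Set.indicator_of_notMem hx]
          have hx2 : 2 < |N⁻¹ * x| := by
            rw [abs_mul, abs_of_nonneg (inv_nonneg.2 hN0.le), lt_inv_mul_iff₀ hN0]
            rw [Set.mem_Icc, ← abs_le, not_le] at hx
            linarith
          have z1 : deriv η (N⁻¹ * x) = 0 := by
            by_contra h
            exact hts _ hx2 (support_deriv_subset h)
          have z2 : deriv (deriv η) (N⁻¹ * x) = 0 := by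
            by_contra h
            exact hts _ hx2 (closure_minimal support_deriv_subset (isClosed_tsupport _)
              (support_deriv_subset h))
          rw [d2, d1]
          simp [z1, z2]
      refine (integral_mono_of_nonneg (.of_forall fun x => by positivity)
        ((integrable_indicator_iff measurableSet_Icc).2 (integrableOn_const (by simp)))
        (.of_forall hpt)).trans ?_
      rw [integral_indicator measurableSet_Icc, setIntegral_const, Real.volume_real_Icc_of_le
        (by linarith), smul_eq_mul]
      have : (2 * N - -(2 * N)) * (N⁻¹ * K) ^ 2 = 4 * K ^ 2 * N⁻¹ := by
        field_simp
        ring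
      rw [this]
      exact mul_le_of_le_one_right (by positivity) (inv_le_one_of_one_le₀ hN)
    exact hlow.trans (hle.trans (mul_le_mul_of_nonneg_left hup (by positivity)))
  obtain ⟨N, hN, hN1⟩ := ((hinf.eventually_gt_atTop (‖R‖ ^ 2 * (4 * K ^ 2))).and
    (Filter.eventually_ge_atTop 1)).exists
  exact absurd (key N hN1) (not_le.2 hN)

theorem mem_spectrum_of_discriminant {ω : ℝ} (hω : 0 < ω) (hV : LocallyIntegrable V volume)
    (hper : ∀ᵐ x : ℝ, V (x + ω) = V x) {t : ℝ} (ht : discriminant V ω E = t) (h1 : -1 ≤ t)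
    (h2 : t ≤ 1) : E ∈ spectrum (hillOperator V) := by
  obtain ⟨ρ, f, hρ, hf, hf0, hfρ⟩ := exists_bloch_solution hV hper ht h1 h2
  have cf := hf.1.differentiable.continuous
  have cf' := hf.1.locallyAC_deriv.continuous
  have hderiv : ∀ x, deriv f (x + ω) = ρ * deriv f x := fun x => by
    rw [← deriv_comp_add_const, funext hfρ, deriv_const_mul _ (hf.1.differentiable x)]
  have p1 : Function.Periodic (fun x => ‖f x‖) ω := fun x => by
    simp only [hfρ, norm_mul, hρ, one_mul]
  have p2 : Function.Periodic (fun x => ‖deriv f x‖) ω := fun x => by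
    simp only [hderiv, norm_mul, hρ, one_mul]
  obtain ⟨C₁, hC₁⟩ := (p1.isBounded_of_continuous hω.ne' cf.norm).exists_norm_le
  obtain ⟨C₂, hC₂⟩ := (p2.isBounded_of_continuous hω.ne' cf'.norm).exists_norm_le
  have p3 : Function.Periodic (fun x => ‖f x‖ ^ 2) ω := fun x => by
    simp only [hfρ, norm_mul, hρ, one_mul]
  refine mem_spectrum_of_bounded_solution hf (C := max C₁ C₂)
    (fun x => ?_) (fun x => ?_) (p3.tendsto_atTop_intervalIntegral_of_pos ?_ hω)
  · simpa using Or.inl (hC₁ _ ⟨x, rfl⟩)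
  · simpa using Or.inr (hC₂ _ ⟨x, rfl⟩)
  · obtain ⟨x, hx⟩ := Function.ne_iff.1 hf0
    obtain ⟨y, hy, hxy⟩ := p3.exists_mem_Ico₀ hω x
    refine intervalIntegral.integral_pos hω (cf.norm.pow 2).continuousOn
      (fun _ _ => by positivity) ⟨y, Set.Ico_subset_Icc_self hy, ?_⟩
    exact (pow_pos (norm_pos_iff.2 hx) 2).trans_eq hxy

end Hill

/-! ### The antiunitary symmetry -/

namespace Hill

variable {V : ℝ → ℂ} {E : ℂ}

/-- The underlying function of the antiunitary operator `𝒫𝒯`, `f ↦ (x ↦ conj (f (-x)))`. -/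
noncomputable def ptFun (f : L2) : L2 :=
  star (Lp.compMeasurePreserving Neg.neg (Measure.measurePreserving_neg volume) f)

theorem coeFn_ptFun (f : L2) : ptFun f =ᵐ[volume] fun x => conj (f (-x)) := by
  filter_upwards [Lp.coeFn_star (Lp.compMeasurePreserving Neg.neg
      (Measure.measurePreserving_neg (volume : Measure ℝ)) f),
    Lp.coeFn_compMeasurePreserving f (Measure.measurePreserving_neg (volume : Measure ℝ))]
    with x h1 h2
  rw [ptFun, h1, Pi.star_apply, h2]
  rfl

theorem ptFun_ae_eq {f : L2} {g : ℝ → ℂ} (h : f =ᵐ[volume] g) :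
    ptFun f =ᵐ[volume] fun x => conj (g (-x)) := by
  filter_upwards [coeFn_ptFun f, ae_comp_neg h] with x h1 h2
  rw [h1, h2]

/-- The antiunitary involution `f ↦ (x ↦ conj (f (-x)))` of `L²(ℝ)`, denoted `𝒫𝒯`. -/
noncomputable def pt : L2 →ₛₗᵢ[starRingEnd ℂ] L2 where
  toFun := ptFun
  map_add' f g := by
    refine Lp.ext ?_
    filter_upwards [coeFn_ptFun (f + g), coeFn_ptFun f, coeFn_ptFun g,
      Lp.coeFn_add (ptFun f) (ptFun g), ae_comp_neg (Lp.coeFn_add f g)] with x h1 h2 h3 h4 h5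
    rw [h1, h4, Pi.add_apply, h2, h3, h5, Pi.add_apply, map_add]
  map_smul' c f := by
    refine Lp.ext ?_
    filter_upwards [coeFn_ptFun (c • f), coeFn_ptFun f,
      Lp.coeFn_smul (conj c) (ptFun f), ae_comp_neg (Lp.coeFn_smul c f)] with x h1 h2 h3 h4
    rw [h1, h3, Pi.smul_apply, h2, h4, Pi.smul_apply, smul_eq_mul, smul_eq_mul, map_mul]
  norm_map' f := by
    refine (pow_left_inj₀ (norm_nonneg _) (norm_nonneg _) two_ne_zero).1 ?_
    change ‖ptFun f‖ ^ 2 = ‖f‖ ^ 2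
    rw [norm_sq_eq_integral _ (coeFn_ptFun f), norm_sq_eq_integral f .rfl,
      ← integral_neg_eq_self]
    simp

theorem pt_ae_eq {f : L2} {g : ℝ → ℂ} (h : f =ᵐ[volume] g) :
    pt f =ᵐ[volume] fun x => conj (g (-x)) := ptFun_ae_eq h

theorem pt_pt (f : L2) : pt (pt f) = f := by
  refine Lp.ext ((pt_ae_eq (pt_ae_eq .rfl)).trans ?_)
  simp

theorem expr_conj_comp_neg (hPT : ∀ᵐ x : ℝ, conj (V (-x)) = V x) (g : ℝ → ℂ) :
    expr V (fun x => conj (g (-x))) =ᵐ[volume] fun x => conj (expr V g (-x)) := by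
  filter_upwards [hPT] with x hx
  simp only [expr, deriv_deriv_conj_comp_neg, map_add, map_neg, map_mul, hx]

theorem memLp_expr_conj_comp_neg (hPT : ∀ᵐ x : ℝ, conj (V (-x)) = V x) {g : ℝ → ℂ}
    (hg : MemLp (expr V g) 2 volume) : MemLp (expr V (fun x => conj (g (-x)))) 2 volume :=
  (Lp.memLp (pt (hg.toLp _))).ae_eq
    ((pt_ae_eq hg.coeFn_toLp).trans (expr_conj_comp_neg hPT g).symm)

/-- `𝒫𝒯` maps the domain of the Hill operator to itself and commutes with the operator. -/
theorem exists_domain_pt (hPT : ∀ᵐ x : ℝ, conj (V (-x)) = V x)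
    (f : (hillOperator V).domain) :
    ∃ f' : (hillOperator V).domain, (f' : L2) = pt f ∧
      hillOperator V f' = pt (hillOperator V f) := by
  obtain ⟨h1, h2, h3⟩ := rep_spec f
  have e := pt_ae_eq h1
  refine ⟨⟨pt f, _, e, h2.conj_comp_neg, memLp_expr_conj_comp_neg hPT h3⟩, rfl, Lp.ext ?_⟩
  refine (coe_hillOperator_ae _ h2.conj_comp_neg e).trans
    ((expr_conj_comp_neg hPT _).trans ?_)
  exact (pt_ae_eq (coe_hillOperator_ae f h2 h1)).symm

/-- If `R` is the resolvent at `E`, then `𝒫𝒯 R 𝒫𝒯` is the resolvent at `conj E`. -/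
theorem mem_spectrum_of_conj_mem (hPT : ∀ᵐ x : ℝ, conj (V (-x)) = V x)
    (h : conj E ∈ spectrum (hillOperator V)) : E ∈ spectrum (hillOperator V) := by
  rintro ⟨R, hR₁, hR₂⟩
  have hpt : ∀ (f g : L2) (z : ℂ), pt (f - z • g) = pt f - conj z • pt g := fun f g z => by
    rw [map_sub, LinearIsometry.map_smulₛₗ]
  refine h ⟨pt.toContinuousLinearMap.comp (R.comp pt.toContinuousLinearMap), fun g => ?_,
    fun f => ?_⟩
  · obtain ⟨f, hf, hfg⟩ := hR₁ (pt g)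
    obtain ⟨f', hf', hTf'⟩ := exists_domain_pt hPT f
    refine ⟨f', ?_, ?_⟩
    · rw [hf', hf]
      rfl
    · rw [hTf', hf', ← hpt, hfg, pt_pt]
  · obtain ⟨f', hf', hTf'⟩ := exists_domain_pt hPT f
    change pt (R (pt (hillOperator V f - conj E • (f : L2)))) = f
    rw [hpt, Complex.conj_conj, ← hTf', ← hf', hR₂, hf', pt_pt]

/-! ### Local extrema of the discriminant -/

/-- An entire function near a point at which its restriction to the real axis has a local
extremum takes real values arbitrarily close to the extremal one at nonreal points: it is either
locally constant or open, and in the second case it takes a value beyond the extremal one. -/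
theorem exists_nonreal_of_isLocalExtr {F : ℂ → ℂ} (hF : Differentiable ℂ F)
    (hreal : ∀ t : ℝ, (F t).im = 0) {t₀ : ℝ}
    (hext : IsLocalMax (fun t : ℝ => (F t).re) t₀ ∨ IsLocalMin (fun t : ℝ => (F t).re) t₀)
    {U : Set ℝ} (hU : U ∈ nhds (F t₀).re) : ∃ z : ℂ, z.im ≠ 0 ∧ ∃ s ∈ U, F z = s := by
  have hF₀ : F t₀ = ((F t₀).re : ℂ) := Complex.ext rfl (by simpa using hreal t₀)
  have han : AnalyticAt ℂ F t₀ := hF.analyticAt t₀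
  rcases han.eventually_constant_or_nhds_le_map_nhds with hconst | hopen
  · -- in the constant case, approach `t₀` vertically
    have hlim : Filter.Tendsto (fun y : ℝ => (t₀ : ℂ) + y * Complex.I)
        (nhdsWithin 0 {0}ᶜ) (nhds (t₀ : ℂ)) := by
      have : Continuous fun y : ℝ => (t₀ : ℂ) + y * Complex.I := by fun_prop
      exact (this.tendsto' 0 _ (by simp)).mono_left nhdsWithin_le_nhds
    obtain ⟨y, hy, hy0⟩ := ((hlim.eventually hconst).and self_mem_nhdsWithin).exists
    exact ⟨_, by simpa using hy0, _, mem_of_mem_nhds hU, hy.trans hF₀⟩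
  · -- the values of `F` at real points near `t₀` stay on the side `S` of the extremal value
    obtain ⟨S, hS, hS'⟩ : ∃ S : Set ℝ, (∀ᶠ t : ℝ in nhds t₀, (F t).re ∈ S) ∧
        ∃ᶠ s in nhds (F t₀).re, s ∉ S := by
      rcases hext with h | h
      · refine ⟨Set.Iic (F t₀).re, h, ?_⟩
        simp only [Set.mem_Iic, not_le]
        exact frequently_gt_nhds _
      · refine ⟨Set.Ici (F t₀).re, h, ?_⟩
        simp only [Set.mem_Ici, not_le]
        exact frequently_lt_nhds _
    obtain ⟨r, hr, hball⟩ := Metric.eventually_nhds_iff_ball.1 hS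
    have himg : F '' Metric.ball (t₀ : ℂ) r ∈ nhds (F t₀) :=
      hopen (Filter.image_mem_map (Metric.ball_mem_nhds _ hr))
    rw [hF₀] at himg
    have hev := Complex.continuous_ofReal.continuousAt.preimage_mem_nhds himg
    obtain ⟨s, hsS, hsU, z, hz, hzs⟩ := (hS'.and_eventually
      ((Filter.eventually_mem_set.2 hU).and (Filter.eventually_mem_set.2 hev))).exists
    refine ⟨z, fun him => hsS ?_, s, hsU, hzs⟩
    have hzr : z = (z.re : ℂ) := Complex.ext rfl (by simpa using him)
    rw [hzr] at hz hzs
    have := hball z.re (by rwa [Metric.mem_ball, Complex.isometry_ofReal.dist_eq] at hz)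
    rwa [hzs, Complex.ofReal_re] at this

end Hill

theorem corollary1 (V : ℝ → ℂ) (ω : ℝ) (hω : 0 < ω)
    (hV : LocallyIntegrable V volume)
    (hper : ∀ᵐ x : ℝ, V (x + ω) = V x)
    (hPT : ∀ᵐ x : ℝ, conj (V (-x)) = V x) :
    -- the initial value problems defining `φ₁`, `φ₂`, hence `Δ`, are uniquely solvable
    (∀ E a b : ℂ, ∃! ψ : ℝ → ℂ, Hill.IsSolutionWith V E a b ψ) ∧
    -- `Δ` is real on `ℝ`
    (∀ E : ℝ, (Hill.discriminant V ω E).im = 0) ∧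
    -- `σ(H)` is symmetric about the real axis
    (∀ E : ℂ, conj E ∈ Hill.spectrum (Hill.hillOperator V) ↔
      E ∈ Hill.spectrum (Hill.hillOperator V)) ∧
    -- a local extremum of `Δ|ℝ` with value in `(-1, 1)` forces nonreal spectrum
    (∀ E₀ : ℝ,
      (IsLocalMax (fun t : ℝ => (Hill.discriminant V ω t).re) E₀ ∨
        IsLocalMin (fun t : ℝ => (Hill.discriminant V ω t).re) E₀) →
      -1 < (Hill.discriminant V ω E₀).re → (Hill.discriminant V ω E₀).re < 1 →
      ∃ E ∈ Hill.spectrum (Hill.hillOperator V), E.im ≠ 0) := by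
  have hreal := Hill.discriminant_im_eq_zero hV hper hPT
  refine ⟨fun E a b => ?_, hreal, fun E => ⟨Hill.mem_spectrum_of_conj_mem hPT, fun h => ?_⟩,
    fun E₀ hext h1 h2 => ?_⟩
  · obtain ⟨f, hf⟩ := Hill.exists_isSolutionWith hV E a b
    exact ⟨f, hf, fun g hg => hg.unique hV hf⟩
  · exact Hill.mem_spectrum_of_conj_mem hPT (by rwa [Complex.conj_conj])
  · obtain ⟨E, hE, s, hs, hEs⟩ := Hill.exists_nonreal_of_isLocalExtr
      (Hill.differentiable_discriminant hV ω) hreal hext (Ioo_mem_nhds h1 h2)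
    exact ⟨E, Hill.mem_spectrum_of_discriminant hω hV hper hEs hs.1.le hs.2.le, hE⟩
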